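/- **Theorem 5.9 (Lambert series expansion of the differential Eisenstein series).** Let $\tau$ range over the complex upper half plane, and take complex powers $z^{s}$ ($z\neq0$) with the branch $-\pi\le\arg z<\pi$. For $\operatorname{Re}(s)>2$ put $$G(s,\tau)=\sum_{(m,n)\in\mathbb{Z}^2\setminus\{(0,0)\}}(m\tau+n)^{-s}.$$ This series converges absolutely, and for each $\tau$ it has an analytic continuation, again denoted $G(s,\tau)$, to an entire function of $s\in\mathbb{C}$. For $m\in\mathbb{Z}$ let $G'_{m}(\tau)=\frac{\partial}{\partial s}G(s,\tau)\big|_{s=m}$. Then, for every integer $k\ge1$ and every $\tau$ in the upper half plane, $$G'_{-2k}(\tau)=\frac{(-1)^k(2k)!}{(2\pi)^{2k}}\Big\{2\sum_{n=1}^{\infty}\frac{n^{-2k-1}}{1-e^{2\pi i n\tau}}-\zeta(2k+1)\Big\}=\frac{(-1)^k(2k)!}{(2\pi)^{2k}}\Big\{\zeta(2k+1)+2\sum_{n=1}^{\infty}\sigma_{-2k-1}(n)\,e^{2\pi i n\tau}\Big\},$$ where $\sigma_{r}(n)=\sum_{d\mid n}d^{r}$ and both series converge absolutely. In particular, the constant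 term is $$G'_{-2k}(i\infty)=\lim_{\operatorname{Im}\tau\to\infty}G'_{-2k}(\tau)=\frac{(-1)^k(2k)!}{(2\pi)^{2k}}\,\zeta(2k+1)\neq0.$$ -/

import Mathlib

noncomputable section

/-- The argument of `z` normalised by `-π ≤ arg z < π`, so that negative reals have argument `-π`
(`Complex.arg` uses `-π < arg z ≤ π`). -/
def lowerArg (z : ℂ) : ℝ :=
  if Complex.arg z = Real.pi then -Real.pi else Complex.arg z

/-- The complex power `z ^ s` for `z ≠ 0`, with the branch `-π ≤ arg z < π`. -/
def lowerPow (z s : ℂ) : ℂ :=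
  Complex.exp (s * ((Real.log ‖z‖ : ℂ) + (lowerArg z : ℂ) * Complex.I))

/-- The summand `(m τ + n) ^ (-s)` of the generalized Eisenstein series, indexed by the pairs
`(m, n) ≠ (0, 0)`; for `τ` in the upper half plane these are exactly the pairs for which
`m τ + n ≠ 0`. -/
def eisensteinTerm (τ : UpperHalfPlane) (s : ℂ) (p : {p : ℤ × ℤ // p ≠ (0, 0)}) : ℂ :=
  lowerPow ((p.1.1 : ℂ) * (τ : ℂ) + (p.1.2 : ℂ)) (-s)

/-- `F` is the analytic continuation to the whole `s`-plane of the absolutely convergent series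
`∑' (m τ + n) ^ (-s)`, `Re s > 2`. -/
def IsEisensteinContinuation (τ : UpperHalfPlane) (F : ℂ → ℂ) : Prop :=
  Differentiable ℂ F ∧ ∀ s : ℂ, 2 < s.re → HasSum (eisensteinTerm τ s) (F s)

/-- There is at most one analytic continuation. -/
theorem IsEisensteinContinuation.unique {τ : UpperHalfPlane} {F₁ F₂ : ℂ → ℂ}
    (h₁ : IsEisensteinContinuation τ F₁) (h₂ : IsEisensteinContinuation τ F₂) : F₁ = F₂ := by
  have ha : ∀ {F : ℂ → ℂ}, Differentiable ℂ F → AnalyticOnNhd ℂ F Set.univ :=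
    fun hF => hF.differentiableOn.analyticOnNhd isOpen_univ
  refine (ha h₁.1).eq_of_eventuallyEq (ha h₂.1) (z₀ := 3) ?_
  have ho : IsOpen {s : ℂ | 2 < s.re} := isOpen_lt continuous_const Complex.continuous_re
  filter_upwards [ho.mem_nhds (show (3 : ℂ) ∈ {s : ℂ | 2 < s.re} by norm_num)] with s hs
  exact (h₁.2 s hs).unique (h₂.2 s hs)

/-- The generalized Eisenstein series `G(s, τ)` for all `s : ℂ`, that is, the analytic
continuation in `s` of the series. -/
def generalizedEisenstein (s : ℂ) (τ : UpperHalfPlane) : ℂ :=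
  Classical.epsilon (IsEisensteinContinuation τ) s

/-- The differential Eisenstein series `G'_m(τ) = ∂G(s, τ)/∂s` at `s = m`. -/
def diffEisenstein (m : ℤ) (τ : UpperHalfPlane) : ℂ :=
  deriv (fun s : ℂ => generalizedEisenstein s τ) (m : ℂ)

/-- The divisor function `σ_r(n) = ∑_{d ∣ n} d ^ r` for an arbitrary integer exponent `r`. -/
def divisorPowSum (r : ℤ) (n : ℕ) : ℂ :=
  ∑ d ∈ n.divisors, (d : ℂ) ^ r

end

/-! ### The power function with argument in `[-π, π)` -/

/-! With arguments in `[-π, π)`, negating a point of the upper half plane or of the positive axis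
multiplies its power `-s` by `exp (π i s)`. The rows `m` and `-m`, and the two halves of row `0`,
therefore combine with the common factor `1 + exp (π i s)`. Row `0` gives `ζ(s)`, and Lipschitz's
formula (`lipschitz_formula`, from Poisson summation) turns row `m > 0` into a series in powers of
`q ^ m` with `1 / Γ(s)` in front. Summing over `m` is geometric and yields `tsum_eisensteinTermExt`,
whose right side is entire: the zero of `1 + exp (π i s)` at `1` cancels the pole of `ζ`.

At `s = -2k` both `ζ` and `1 / Γ` have simple zeros, so the derivative only needs
`hasDerivAt_riemannZeta_neg_two_mul` and `hasDerivAt_Gamma_inv_neg_nat`; the two contributions share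
one constant. Regrouping by divisors, or writing `1 / (1 - x) = 1 + x / (1 - x)`, gives the two
expansions. -/

theorem norm_lowerPow_le {w : ℂ} (hw : w ≠ 0) (s : ℂ) :
    ‖lowerPow w s‖ ≤ ‖w‖ ^ s.re * Real.exp (Real.pi * |s.im|) := by
  have h : |lowerArg w| ≤ Real.pi := by
    unfold lowerArg
    split_ifs
    · rw [abs_neg, abs_of_pos Real.pi_pos]
    · exact Complex.abs_arg_le_pi w
  rw [lowerPow, Complex.norm_exp, Real.rpow_def_of_pos (norm_pos_iff.mpr hw), ← Real.exp_add,
    Real.exp_le_exp]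
  have h2 : -(s.im * lowerArg w) ≤ Real.pi * |s.im| :=
    calc -(s.im * lowerArg w) ≤ |s.im * lowerArg w| := neg_le_abs _
      _ = |s.im| * |lowerArg w| := abs_mul _ _
      _ ≤ |s.im| * Real.pi := by gcongr
      _ = _ := mul_comm _ _
  simp only [Complex.mul_re, Complex.add_re, Complex.add_im, Complex.ofReal_re, Complex.ofReal_im,
    Complex.mul_im, Complex.I_re, Complex.I_im]
  linarith

theorem lowerPow_eq_cpow {w : ℂ} (hw : w ≠ 0) (ha : w.arg ≠ Real.pi) (s : ℂ) :
    lowerPow w s = w ^ s := by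
  rw [lowerPow, lowerArg, if_neg ha, Complex.cpow_def_of_ne_zero hw, Complex.log, mul_comm]

/-- The argument drops by exactly `π` and stays inside `(-π, 0)`, away from the cut. -/
theorem lowerPow_neg_of_im_pos {w : ℂ} (hw : 0 < w.im) (s : ℂ) :
    lowerPow (-w) (-s) = Complex.exp (Real.pi * Complex.I * s) * lowerPow w (-s) := by
  have h1 : w.arg ≠ Real.pi := fun h => by
    rw [Complex.arg_eq_pi_iff] at h
    exact hw.ne' h.2
  have h2 : w.arg - Real.pi ≠ Real.pi := by
    have := Complex.arg_le_pi w
    have := Real.pi_pos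
    linarith
  rw [lowerPow, lowerPow, lowerArg, lowerArg, Complex.arg_neg_eq_arg_sub_pi_of_im_pos hw,
    if_neg h1, if_neg h2, norm_neg, ← Complex.exp_add]
  congr 1
  push_cast
  ring

theorem lowerPow_natCast {n : ℕ} (hn : n ≠ 0) (s : ℂ) : lowerPow n s = (n : ℂ) ^ s := by
  refine lowerPow_eq_cpow (by exact_mod_cast hn) ?_ s
  rw [Complex.natCast_arg]
  exact Real.pi_pos.ne

/-- Here the base lies on the cut; the value `-π` gives the same factor as in the upper half plane,
while the principal branch would give its inverse. -/
theorem lowerPow_neg_natCast {n : ℕ} (hn : n ≠ 0) (s : ℂ) :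
    lowerPow (-(n : ℂ)) (-s) = Complex.exp (Real.pi * Complex.I * s) * (n : ℂ) ^ (-s) := by
  have h0 : (n : ℂ) ≠ 0 := by exact_mod_cast hn
  have h1 : (-(n : ℂ)).arg = Real.pi := by
    have : (-(n : ℂ)) = ((-(n : ℝ) : ℝ) : ℂ) := by push_cast; rfl
    rw [this, Complex.arg_ofReal_of_neg]
    have : 0 < (n : ℝ) := by positivity
    linarith
  rw [lowerPow, lowerArg, if_pos h1, norm_neg, Complex.cpow_def_of_ne_zero h0, ← Complex.exp_add,
    ← Complex.ofReal_natCast, Complex.norm_real, ← Complex.ofReal_log (by positivity),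
    Real.norm_of_nonneg (by positivity)]
  congr 1
  push_cast
  ring

/-! ### Absolute convergence -/

/-- The terms of the generalized Eisenstein series, extended by zero to all of `ℤ × ℤ`. -/
noncomputable def eisensteinTermExt (τ : UpperHalfPlane) (s : ℂ) (p : ℤ × ℤ) : ℂ :=
  Set.indicator {p : ℤ × ℤ | p ≠ (0, 0)}
    (fun p => lowerPow ((p.1 : ℂ) * (τ : ℂ) + (p.2 : ℂ)) (-s)) p

theorem UpperHalfPlane.linear_ne_zero_of_pair (τ : UpperHalfPlane) {p : ℤ × ℤ} (hp : p ≠ (0, 0)) :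
    (p.1 : ℂ) * (τ : ℂ) + (p.2 : ℂ) ≠ 0 := by
  intro h
  have him := congrArg Complex.im h
  have hre := congrArg Complex.re h
  simp at him hre
  have h1 : p.1 = 0 := by
    rcases him with h | h
    · exact h
    · exact absurd h τ.im_pos.ne'
  rw [h1] at hre
  simp at hre
  exact hp (Prod.ext h1 hre)

theorem summable_eisensteinTermExt (τ : UpperHalfPlane) {s : ℂ} (hs : 2 < s.re) :
    Summable (eisensteinTermExt τ s) := by
  -- Since the argument is bounded by `π`, a complex exponent costs only the constant `exp (π |Im
  -- s|)`.
  have h := ((EisensteinSeries.summable_one_div_norm_rpow hs).mul_left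
    (EisensteinSeries.r τ ^ (-s.re))).mul_right (Real.exp (Real.pi * |(-s).im|))
  rw [← (finTwoArrowEquiv ℤ).symm.summable_iff] at h
  refine Summable.of_norm_bounded h fun p => ?_
  by_cases hp : p = (0, 0)
  · rw [eisensteinTermExt, Set.indicator_of_notMem (by simpa using hp), norm_zero]
    have := (EisensteinSeries.r_pos τ).le
    simp only [Function.comp_apply]
    positivity
  · rw [eisensteinTermExt, Set.indicator_of_mem (by simpa using hp)]
    refine (norm_lowerPow_le (τ.linear_ne_zero_of_pair hp) _).trans ?_
    simp only [Function.comp_apply]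
    gcongr
    simpa using EisensteinSeries.summand_bound τ (by linarith : 0 ≤ s.re)
      ((finTwoArrowEquiv ℤ).symm p)

theorem summable_add_int_cpow {z : ℂ} (hz : 0 < z.im) {s : ℂ} (hs : 2 < s.re) :
    Summable fun n : ℤ => (z + n) ^ (-s) := by
  have h := (summable_eisensteinTermExt ⟨z, hz⟩ hs).comp_injective
    (Prod.mk_right_injective (1 : ℤ) (β := ℤ))
  refine h.congr fun n => ?_
  have hi : 0 < (z + n).im := by simpa using hz
  simp only [Function.comp_apply, eisensteinTermExt]
  rw [Set.indicator_of_mem (by simp), ← lowerPow_eq_cpow]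
  · simp
  · intro h0; simp [h0] at hi
  · intro h0; rw [Complex.arg_eq_pi_iff] at h0; exact hi.ne' h0.2

/-! ### The Gamma integral with complex rate -/

/-- Both sides are holomorphic in `r` on the right half plane and agree for real `r > 0`; the
identity theorem does the rest. -/
theorem Complex.integral_cpow_mul_exp_neg_mul_Ioi_of_re_pos {a r : ℂ} (ha : 0 < a.re)
    (hr : 0 < r.re) :
    ∫ t : ℝ in Set.Ioi 0, (t : ℂ) ^ (a - 1) * Complex.exp (-(r * t)) =
      r ^ (-a) * Complex.Gamma a := by
  have hint : ∀ {c b : ℝ}, 0 < b → 0 < c → MeasureTheory.IntegrableOn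
      (fun t : ℝ => t ^ (b - 1) * Real.exp (-(c * t))) (Set.Ioi 0) := by
    intro c b hb hc
    simpa using integrableOn_rpow_mul_exp_neg_mul_rpow (s := b - 1) (p := 1) (by linarith)
      zero_lt_one hc
  have hcont : ∀ (b r : ℂ), ContinuousOn (fun t : ℝ => (t : ℂ) ^ b * Complex.exp (-(r * t)))
      (Set.Ioi 0) := by
    intro b r t ht
    refine ContinuousAt.continuousWithinAt (ContinuousAt.mul ?_ (by fun_prop))
    exact (continuousAt_ofReal_cpow_const _ _ (Or.inr (ne_of_gt ht)))
  have hnorm : ∀ (b r : ℂ) {t : ℝ}, 0 < t → ‖(t : ℂ) ^ b * Complex.exp (-(r * t))‖ =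
      t ^ b.re * Real.exp (-(r.re * t)) := by
    intro b r t ht
    rw [norm_mul, Complex.norm_cpow_eq_rpow_re_of_pos ht, Complex.norm_exp]
    simp
  have hd : DifferentiableOn ℂ (fun r : ℂ => ∫ t : ℝ in Set.Ioi 0,
      (t : ℂ) ^ (a - 1) * Complex.exp (-(r * t))) {r | 0 < r.re} := by
    intro r hr
    have hr : 0 < r.re := hr
    refine DifferentiableAt.differentiableWithinAt ?_
    have hU : {x : ℂ | r.re / 2 < x.re} ∈ nhds r :=
      (isOpen_lt continuous_const Complex.continuous_re).mem_nhds
        (show r.re / 2 < r.re by linarith)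
    refine (hasDerivAt_integral_of_dominated_loc_of_deriv_le
      (F' := fun r t => -((t : ℂ) ^ a * Complex.exp (-(r * t))))
      -- Differentiating in `r` brings down a factor `t`, hence `a.re + 1`; the rate `r.re / 2` is
      -- uniform on the neighbourhood.
      (bound := fun t : ℝ => t ^ ((a.re + 1) - 1) * Real.exp (-(r.re / 2 * t))) hU
      ?_ ?_ ?_ ?_ ?_ ?_).2.differentiableAt
    · exact Filter.Eventually.of_forall fun x =>
        (hcont _ _).aestronglyMeasurable measurableSet_Ioi
    · refine (hint ha hr).mono' ((hcont _ _).aestronglyMeasurable measurableSet_Ioi) ?_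
      filter_upwards [MeasureTheory.ae_restrict_mem measurableSet_Ioi] with t ht
      rw [hnorm _ _ ht]
      simp
    · exact ((hcont _ _).aestronglyMeasurable measurableSet_Ioi).neg
    · filter_upwards [MeasureTheory.ae_restrict_mem measurableSet_Ioi] with t ht x hx
      have ht : 0 < t := ht
      have hx : r.re / 2 < x.re := hx
      rw [norm_neg, hnorm _ _ ht, add_sub_cancel_right]
      gcongr
    · exact hint (by linarith) (by linarith)
    · filter_upwards [MeasureTheory.ae_restrict_mem measurableSet_Ioi] with t ht x hx
      have ht0 : (t : ℂ) ≠ 0 := by exact_mod_cast (ne_of_gt ht)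
      have h1 : HasDerivAt (fun x : ℂ => Complex.exp (-(x * t)))
          (Complex.exp (-(x * t)) * -(1 * (t : ℂ))) x :=
        (((hasDerivAt_id x).mul_const (t : ℂ)).neg).cexp
      refine (h1.const_mul ((t : ℂ) ^ (a - 1))).congr_deriv ?_
      rw [Complex.cpow_sub _ _ ht0, Complex.cpow_one]
      field_simp
  have hopen : IsOpen {r : ℂ | 0 < r.re} := isOpen_lt continuous_const Complex.continuous_re
  have hd2 : DifferentiableOn ℂ (fun r : ℂ => r ^ (-a) * Complex.Gamma a) {r | 0 < r.re} := by
    intro r hr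
    exact (((hasDerivAt_id r).cpow_const (Or.inl hr)).differentiableAt.mul_const
      _).differentiableWithinAt
  refine (hd.analyticOnNhd hopen).eqOn_of_preconnected_of_frequently_eq
    (hd2.analyticOnNhd hopen) (convex_halfSpace_re_gt 0).isPreconnected
    (z₀ := 1) (by simp) ?_ hr
  have hseq : Filter.Tendsto (fun n : ℕ => ((1 + 1 / ((n : ℝ) + 1) : ℝ) : ℂ)) Filter.atTop
      (nhdsWithin 1 {1}ᶜ) := by
    refine tendsto_nhdsWithin_iff.mpr ⟨?_, Filter.Eventually.of_forall fun n => ?_⟩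
    · have := (tendsto_one_div_add_atTop_nhds_zero_nat (𝕜 := ℝ)).const_add 1
      rw [add_zero] at this
      exact (Complex.continuous_ofReal.tendsto' 1 1 Complex.ofReal_one).comp this
    · have : (0 : ℝ) < 1 / ((n : ℝ) + 1) := by positivity
      simp only [Set.mem_compl_iff, Set.mem_singleton_iff]
      rw [← Complex.ofReal_one, Complex.ofReal_inj]
      linarith
  refine hseq.frequently (Filter.Frequently.of_forall fun n => ?_)
  have hpos : (0 : ℝ) < 1 + 1 / ((n : ℝ) + 1) := by positivity
  rw [Complex.integral_cpow_mul_exp_neg_mul_Ioi ha hpos, one_div, Complex.inv_cpow,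
    Complex.cpow_neg]
  rw [Complex.arg_ofReal_of_nonneg hpos.le]
  exact Real.pi_pos.ne

/-! ### The Lipschitz summation formula -/

/-- The function `t ↦ t ^ (s - 1) * exp (2 π i t z)` on `t > 0`, extended by zero. -/
noncomputable def lipschitzKernel (s z : ℂ) (t : ℝ) : ℂ :=
  ((max t 0 : ℝ) : ℂ) ^ (s - 1) * Complex.exp (2 * Real.pi * Complex.I * t * z)

theorem lipschitzKernel_of_nonpos {s : ℂ} (hs : 1 < s.re) (z : ℂ) {t : ℝ} (ht : t ≤ 0) :
    lipschitzKernel s z t = 0 := by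
  -- The convention `0 ^ 0 = 1` would spoil the extension by zero.
  have : s - 1 ≠ 0 := fun h => by
    have := congrArg Complex.re h
    simp at this
    linarith
  rw [lipschitzKernel, max_eq_right ht, Complex.ofReal_zero, Complex.zero_cpow this, zero_mul]

theorem continuous_lipschitzKernel {s : ℂ} (hs : 1 < s.re) (z : ℂ) :
    Continuous (lipschitzKernel s z) := by
  have h : 0 < (s - 1).re := by simpa using hs
  have h1 := (Complex.continuous_ofReal_cpow_const h).comp
    (continuous_id.max (continuous_const (y := (0 : ℝ))) : Continuous fun t : ℝ => max t 0)
  exact h1.mul (by fun_prop)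

theorem lipschitzKernel_isBigO {s z : ℂ} (hs : 1 < s.re) (hz : 0 < z.im) :
    lipschitzKernel s z =O[Filter.cocompact ℝ] fun x : ℝ => |x| ^ (-2 : ℝ) := by
  rw [cocompact_eq_atBot_atTop, Asymptotics.isBigO_sup]
  constructor
  · refine (Asymptotics.isBigO_zero _ _).congr' ?_ Filter.EventuallyEq.rfl
    filter_upwards [Filter.eventually_le_atBot 0] with t ht
    rw [lipschitzKernel_of_nonpos hs z ht]
  · have h1 := (isLittleO_exp_neg_mul_rpow_atTop (a := 2 * Real.pi * z.im) (by positivity)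
      -- Chosen so that multiplying by `t ^ (s.re - 1)` leaves `t ^ (-2)`.
      (-2 - (s.re - 1))).isBigO
    have h2 := (Asymptotics.isBigO_refl (fun t : ℝ => t ^ (s.re - 1)) Filter.atTop).mul h1
    refine (Asymptotics.IsBigO.of_norm_left ?_)
    refine h2.congr' ?_ ?_
    · filter_upwards [Filter.eventually_gt_atTop 0] with t ht
      rw [lipschitzKernel, max_eq_left ht.le, norm_mul, Complex.norm_cpow_eq_rpow_re_of_pos ht,
        Complex.norm_exp]
      congr 2
      simp
      ring
    · filter_upwards [Filter.eventually_gt_atTop 0] with t ht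
      rw [← Real.rpow_add ht, abs_of_pos ht]
      congr 1
      ring

/-- The power splits because `arg w - π / 2` lies in `[-π / 2, π / 2]`, so the principal logarithms
add without a jump. -/
theorem cpow_two_pi_mul_neg_I {w : ℂ} (hw : 0 < w.im) (s : ℂ) :
    (-(2 * Real.pi * Complex.I) * w) ^ s =
      (2 * Real.pi : ℂ) ^ s * Complex.exp (-(Real.pi * Complex.I / 2) * s) * w ^ s := by
  have hw0 : w ≠ 0 := fun h => by simp [h] at hw
  have hpi := Real.pi_pos
  have h2 : (2 * Real.pi : ℂ) ≠ 0 := by simp [hpi.ne']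
  have harg0 : 0 ≤ w.arg := Complex.arg_nonneg_iff.mpr hw.le
  have harg1 : w.arg ≤ Real.pi := Complex.arg_le_pi w
  set L : ℂ := Complex.log (2 * Real.pi) - Real.pi * Complex.I / 2 + Complex.log w with hL
  have hLim : L.im = w.arg - Real.pi / 2 := by
    have : (2 * Real.pi : ℂ) = ((2 * Real.pi : ℝ) : ℂ) := by push_cast; rfl
    rw [hL, this, ← Complex.ofReal_log (by positivity)]
    simp [Complex.log_im]
    ring
  have hexp : Complex.exp L = -(2 * Real.pi * Complex.I) * w := by
    rw [hL, Complex.exp_add, Complex.exp_sub, Complex.exp_log h2, Complex.exp_log hw0]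
    have : Complex.exp (Real.pi * Complex.I / 2) = Complex.I := by
      rw [mul_div_right_comm, Complex.exp_pi_div_two_mul_I]
    rw [this, div_eq_mul_inv, Complex.inv_I]
    ring
  have hlog : Complex.log (-(2 * Real.pi * Complex.I) * w) = L := by
    rw [← hexp, Complex.log_exp] <;> rw [hLim] <;> linarith
  rw [Complex.cpow_def_of_ne_zero (by rw [← hexp]; exact Complex.exp_ne_zero _), hlog,
    Complex.cpow_def_of_ne_zero h2, Complex.cpow_def_of_ne_zero hw0, ← Complex.exp_add,
    ← Complex.exp_add, hL]
  congr 1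
  ring

open FourierTransform in
-- This is a Gamma integral with rate `-2 π i (z - ξ)`, whose real part is positive since `Im z >
-- 0`.
theorem fourier_lipschitzKernel {s z : ℂ} (hs : 1 < s.re) (hz : 0 < z.im) (ξ : ℝ) :
    𝓕 (lipschitzKernel s z) ξ = Complex.Gamma s * ((2 * Real.pi : ℂ) ^ (-s) *
      Complex.exp (Real.pi * Complex.I / 2 * s)) * (z - ξ) ^ (-s) := by
  have hw : 0 < (z - ξ).im := by simpa using hz
  have hr : 0 < (-(2 * Real.pi * Complex.I) * (z - ξ)).re := by
    have := Real.pi_pos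
    simp
    positivity
  have h1 : 𝓕 (lipschitzKernel s z) ξ = ∫ t : ℝ in Set.Ioi 0,
      (t : ℂ) ^ (s - 1) * Complex.exp (-((-(2 * Real.pi * Complex.I) * (z - ξ)) * t)) := by
    rw [Real.fourier_real_eq_integral_exp_smul, ← MeasureTheory.integral_indicator
      measurableSet_Ioi]
    congr 1 with t
    by_cases ht : 0 < t
    · rw [Set.indicator_of_mem (by exact ht), lipschitzKernel, max_eq_left ht.le, smul_eq_mul,
        mul_left_comm, ← Complex.exp_add]
      congr 2
      push_cast
      ring
    · rw [Set.indicator_of_notMem (by exact ht), lipschitzKernel_of_nonpos hs z (not_lt.mp ht),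
        smul_zero]
  rw [h1, Complex.integral_cpow_mul_exp_neg_mul_Ioi_of_re_pos (by linarith) hr,
    cpow_two_pi_mul_neg_I hw]
  have : -(Real.pi * Complex.I / 2) * -s = Real.pi * Complex.I / 2 * s := by ring
  rw [this]
  ring

/-- **Lipschitz's formula**. -/
theorem lipschitz_formula {s z : ℂ} (hs : 2 < s.re) (hz : 0 < z.im) :
    ∑' n : ℤ, (z + n) ^ (-s) = (2 * Real.pi : ℂ) ^ s *
      Complex.exp (-(Real.pi * Complex.I / 2 * s)) * (Complex.Gamma s)⁻¹ *
      ∑' n : ℕ+, (n : ℂ) ^ (s - 1) * Complex.exp (2 * Real.pi * Complex.I * n * z) := by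
  have hs1 : 1 < s.re := by linarith
  have hΓ : Complex.Gamma s ≠ 0 := Complex.Gamma_ne_zero_of_re_pos (by linarith)
  have h2 : (2 * Real.pi : ℂ) ≠ 0 := by simp [Real.pi_ne_zero]
  have hsum : Summable fun n : ℤ => (z - n) ^ (-s) := by
    rw [← (Equiv.neg ℤ).summable_iff]
    simpa [Function.comp_def] using summable_add_int_cpow hz hs
  -- Poisson summation at the point `0`: kernel values give the exponential series, transform values
  -- the series over `(z - n) ^ (-s)`.
  have key := Real.tsum_eq_tsum_fourier_of_rpow_decay_of_summable
    (continuous_lipschitzKernel hs1 z) one_lt_two (lipschitzKernel_isBigO hs1 hz) ?_ 0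
  · simp only [zero_add, fourier_lipschitzKernel hs1 hz] at key
    have hl : ∑' n : ℤ, lipschitzKernel s z n =
        ∑' n : ℕ+, (n : ℂ) ^ (s - 1) * Complex.exp (2 * Real.pi * Complex.I * n * z) := by
      have hinj : Function.Injective (fun n : ℕ+ => (n : ℤ)) := fun a b h => by
        simpa using h
      rw [← hinj.tsum_eq]
      · refine tsum_congr fun n => ?_
        have : (0 : ℝ) < (n : ℕ) := by exact_mod_cast n.pos
        simp only [lipschitzKernel, Int.cast_natCast]
        rw [max_eq_left this.le]
        simp
      · intro n hn
        by_contra h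
        refine hn (lipschitzKernel_of_nonpos hs1 z ?_)
        by_contra h3
        have h3 : 0 < n := by
          rw [not_le] at h3
          exact_mod_cast h3
        exact h ⟨⟨n.toNat, by omega⟩, by simp; omega⟩
    have hr : ∑' n : ℤ, (z - n) ^ (-s) = ∑' n : ℤ, (z + n) ^ (-s) := by
      rw [← (Equiv.neg ℤ).tsum_eq]
      simp
    rw [← hl, key]
    simp only [Complex.ofReal_intCast, QuotientAddGroup.mk_zero, fourier_eval_zero, mul_one]
    rw [tsum_mul_left, hr, Complex.cpow_neg (2 * Real.pi : ℂ) s, Complex.exp_neg]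
    have h3 : (2 * Real.pi : ℂ) ^ s ≠ 0 := by simp [Complex.cpow_eq_zero_iff, Real.pi_ne_zero]
    field_simp
  · simp only [fourier_lipschitzKernel hs1 hz]
    exact (hsum.mul_left _).congr fun n => by rw [Complex.ofReal_intCast]

/-! ### Lambert series with polynomially bounded coefficients -/

section Lambert

variable {a : ℕ+ → ℂ} {K : ℕ} {q : ℂ}

theorem summable_lambert_double (ha : ∀ n, ‖a n‖ ≤ (n : ℝ) ^ K) (hq : ‖q‖ < 1) :
    Summable fun p : ℕ+ × ℕ+ => a p.2 * q ^ (p.1 * p.2 : ℕ) := by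
  refine Summable.of_norm_bounded (summable_prod_mul_pow K (r := ‖q‖) (by simpa using hq))
    fun p => ?_
  rw [norm_mul, norm_pow]
  gcongr
  exact ha p.2

theorem tsum_pnat_geometric (hq : ‖q‖ < 1) (n : ℕ+) :
    ∑' m : ℕ+, q ^ (m * n : ℕ) = q ^ (n : ℕ) / (1 - q ^ (n : ℕ)) := by
  have hqn : ‖q ^ (n : ℕ)‖ < 1 := by
    rw [norm_pow]
    exact pow_lt_one₀ (norm_nonneg _) hq n.ne_zero
  rw [tsum_pnat_eq_tsum_succ (f := fun m : ℕ => q ^ (m * n))]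
  simp only [mul_comm _ (n : ℕ), pow_mul, pow_succ]
  rw [tsum_mul_right, tsum_geometric_of_norm_lt_one hqn]
  ring

theorem tsum_tsum_eq_tsum_lambert (ha : ∀ n, ‖a n‖ ≤ (n : ℝ) ^ K) (hq : ‖q‖ < 1) :
    ∑' m : ℕ+, ∑' n : ℕ+, a n * q ^ (m * n : ℕ) =
      ∑' n : ℕ+, a n * (q ^ (n : ℕ) / (1 - q ^ (n : ℕ))) := by
  have h : Summable (Function.uncurry fun m n : ℕ+ => a n * q ^ (m * n : ℕ)) :=
    summable_lambert_double ha hq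
  rw [← h.tsum_comm]
  exact tsum_congr fun n => by rw [tsum_mul_left, tsum_pnat_geometric hq]

theorem norm_one_sub_pow_ge (hq : ‖q‖ < 1) (n : ℕ+) : 1 - ‖q‖ ≤ ‖1 - q ^ (n : ℕ)‖ := by
  have h1 : ‖q ^ (n : ℕ)‖ ≤ ‖q‖ := by
    rw [norm_pow]
    exact pow_le_of_le_one (norm_nonneg _) hq.le n.ne_zero
  have h2 := norm_sub_norm_le (1 : ℂ) (q ^ (n : ℕ))
  rw [norm_one] at h2
  linarith

theorem norm_lambert_term_le {b : ℝ} {c : ℂ} (hc : ‖c‖ ≤ b) (hq : ‖q‖ < 1) (n : ℕ+) :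
    ‖c * (q ^ (n : ℕ) / (1 - q ^ (n : ℕ)))‖ ≤ b * ‖q‖ ^ (n : ℕ) * (1 - ‖q‖)⁻¹ := by
  have h0 : 0 < 1 - ‖q‖ := by linarith
  rw [norm_mul, norm_div, norm_pow, mul_assoc, div_eq_mul_inv]
  gcongr
  · exact (norm_nonneg c).trans hc
  · exact norm_one_sub_pow_ge hq n

theorem summable_lambert_majorant (K : ℕ) (hq : ‖q‖ < 1) :
    Summable fun n : ℕ+ => (n : ℝ) ^ K * ‖q‖ ^ (n : ℕ) * (1 - ‖q‖)⁻¹ :=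
  ((summable_pow_mul_geometric_of_norm_lt_one K (r := ‖q‖)
    (by simpa using hq)).mul_right _).comp_injective PNat.coe_injective

theorem summable_lambert (ha : ∀ n, ‖a n‖ ≤ (n : ℝ) ^ K) (hq : ‖q‖ < 1) :
    Summable fun n : ℕ+ => a n * (q ^ (n : ℕ) / (1 - q ^ (n : ℕ))) :=
  Summable.of_norm_bounded (summable_lambert_majorant K hq)
    fun n => norm_lambert_term_le (ha n) hq n

theorem hasSum_divisors_lambert {f : ℕ → ℂ} (hf : ∀ n : ℕ+, ‖f n‖ ≤ (n : ℝ) ^ K) (hq : ‖q‖ < 1) :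
    HasSum (fun n : ℕ+ => (∑ d ∈ (n : ℕ).divisors, f d) * q ^ (n : ℕ))
      (∑' n : ℕ+, f n * (q ^ (n : ℕ) / (1 - q ^ (n : ℕ)))) := by
  have hs := summable_lambert_double (a := fun n : ℕ+ => f n) hf hq
  rw [← tsum_tsum_eq_tsum_lambert (a := fun n : ℕ+ => f n) hf hq, ← hs.tsum_prod]
  -- Regroups the pairs of the absolutely convergent double series by their product.
  have h := (sigmaAntidiagonalEquivProd.hasSum_iff).mpr hs.hasSum
  convert! h.sigma fun n => hasSum_fintype _ using 2 with n
  rw [Finset.sum_mul, Finset.univ_eq_attach]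
  refine Eq.trans ?_ ((n : ℕ).divisorsAntidiagonal.sum_attach
    fun x : ℕ × ℕ => f x.2 * q ^ (x.1 * x.2)).symm
  rw [Nat.sum_divisorsAntidiagonal' fun x y => f y * q ^ (x * y)]
  exact Finset.sum_congr rfl fun d hd => by
    rw [Nat.div_mul_cancel (Nat.dvd_of_mem_divisors hd)]

end Lambert

/-! ### The analytic continuation -/

/-- The Lambert series `∑ n ^ (s - 1) q ^ n / (1 - q ^ n)`. -/
noncomputable def lambertPower (q s : ℂ) : ℂ :=
  ∑' n : ℕ+, (n : ℂ) ^ (s - 1) * (q ^ (n : ℕ) / (1 - q ^ (n : ℕ)))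

theorem norm_pnat_cpow_le {s : ℂ} {K : ℕ} (hs : s.re ≤ K) (n : ℕ+) :
    ‖(n : ℂ) ^ s‖ ≤ (n : ℝ) ^ K := by
  rw [Complex.norm_natCast_cpow_of_pos n.pos, ← Real.rpow_natCast]
  exact Real.rpow_le_rpow_of_exponent_le (by exact_mod_cast n.pos) hs

theorem differentiable_lambertPower {q : ℂ} (hq : ‖q‖ < 1) : Differentiable ℂ (lambertPower q) := by
  intro s
  -- On the half plane `re < K` one majorant serves all exponents, so the Weierstrass test applies
  -- there.
  obtain ⟨K, hK⟩ := exists_nat_gt s.re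
  have hopen : IsOpen {s : ℂ | s.re < K} := isOpen_lt Complex.continuous_re continuous_const
  refine (Complex.differentiableOn_tsum_of_summable_norm (summable_lambert_majorant K hq) ?_ hopen
    fun n w hw => norm_lambert_term_le (norm_pnat_cpow_le ?_ n) hq n).differentiableAt
    (hopen.mem_nhds hK)
  · intro n w _
    have hn : (n : ℂ) ≠ 0 := by exact_mod_cast n.ne_zero
    exact ((((differentiableAt_id.sub_const 1).const_cpow (Or.inl hn)).mul_const
      _)).differentiableWithinAt
  · have hw : w.re < K := hw
    simp
    linarith

/-- The entire function extending `(1 + exp (π i s)) ζ(s)`. -/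
noncomputable def zetaPart : ℂ → ℂ :=
  Function.update (fun s => (1 + Complex.exp (Real.pi * Complex.I * s)) * riemannZeta s) 1
    (-(Real.pi * Complex.I))

theorem differentiable_zetaPart : Differentiable ℂ zetaPart := by
  rw [← differentiableOn_univ, ← Complex.differentiableOn_compl_singleton_and_continuousAt_iff
    (c := 1) Filter.univ_mem]
  constructor
  · have : DifferentiableOn ℂ (fun s => (1 + Complex.exp (Real.pi * Complex.I * s)) *
        riemannZeta s) (Set.univ \ {1}) := fun s hs =>
      (DifferentiableAt.mul (by fun_prop)
        (differentiableAt_riemannZeta hs.2)).differentiableWithinAt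
    exact this.congr fun s hs => Function.update_of_ne hs.2 _ _
  · rw [zetaPart, continuousAt_update_same]
    have hd : HasDerivAt (fun s : ℂ => 1 + Complex.exp (Real.pi * Complex.I * s))
        (-(Real.pi * Complex.I)) 1 := by
      have := (((hasDerivAt_id (1 : ℂ)).const_mul (Real.pi * Complex.I)).cexp).const_add 1
      refine this.congr_deriv ?_
      simp [Complex.exp_pi_mul_I]
    -- Near `1` the function is the difference quotient of `1 + exp (π i s)` times `(s - 1) ζ(s)`,
    -- which tends to `-π i * 1`.
    have := (hasDerivAt_iff_tendsto_slope.mp hd).mul riemannZeta_residue_one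
    rw [mul_one] at this
    refine this.congr' ?_
    filter_upwards [self_mem_nhdsWithin] with s hs
    have hs : s - 1 ≠ 0 := sub_ne_zero.mpr hs
    simp only [slope, vsub_eq_sub, smul_eq_mul, mul_one, Complex.exp_pi_mul_I]
    field_simp
    ring

/-- The nome `exp (2 π i τ)`. -/
noncomputable def nome (τ : UpperHalfPlane) : ℂ :=
  Complex.exp (2 * Real.pi * Complex.I * τ)

theorem norm_nome_lt_one (τ : UpperHalfPlane) : ‖nome τ‖ < 1 :=
  UpperHalfPlane.norm_exp_two_pi_I_lt_one τ

theorem exp_eq_nome_pow (τ : UpperHalfPlane) (n : ℕ) :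
    Complex.exp (2 * Real.pi * Complex.I * n * (τ : ℂ)) = nome τ ^ n := by
  rw [nome, ← Complex.exp_nat_mul]
  congr 1
  ring

/-- The closed form of the analytic continuation of the generalized Eisenstein series. -/
noncomputable def eisensteinEntire (τ : UpperHalfPlane) (s : ℂ) : ℂ :=
  zetaPart s + (1 + Complex.exp (Real.pi * Complex.I * s)) * ((2 * Real.pi : ℂ) ^ s *
    Complex.exp (-(Real.pi * Complex.I / 2 * s)) * (Complex.Gamma s)⁻¹ * lambertPower (nome τ) s)

theorem differentiable_eisensteinEntire (τ : UpperHalfPlane) :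
    Differentiable ℂ (eisensteinEntire τ) := by
  have h2 : (2 * Real.pi : ℂ) ≠ 0 := by simp [Real.pi_ne_zero]
  refine differentiable_zetaPart.add (Differentiable.mul (by fun_prop)
    (((Differentiable.mul ?_ (by fun_prop)).mul Complex.differentiable_one_div_Gamma).mul
      (differentiable_lambertPower (norm_nome_lt_one τ))))
  exact fun s => differentiableAt_id.const_cpow (Or.inl h2)

section Rows

variable (τ : UpperHalfPlane) {s : ℂ}

theorem eisensteinTermExt_zero_nat (n : ℕ+) :
    eisensteinTermExt τ s (0, n) = (n : ℂ) ^ (-s) := by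
  rw [eisensteinTermExt, Set.indicator_of_mem (by simp)]
  simpa using lowerPow_natCast n.ne_zero (-s)

theorem eisensteinTermExt_zero_neg_nat (n : ℕ+) :
    eisensteinTermExt τ s (0, -n) = Complex.exp (Real.pi * Complex.I * s) * (n : ℂ) ^ (-s) := by
  rw [eisensteinTermExt, Set.indicator_of_mem (by simp)]
  simpa using lowerPow_neg_natCast n.ne_zero s

theorem linear_im_pos (m : ℕ+) (n : ℤ) : 0 < ((m : ℂ) * τ + n).im := by
  have := τ.im_pos
  have : (0 : ℝ) < m := by exact_mod_cast m.pos
  simp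
  positivity

theorem eisensteinTermExt_pnat (m : ℕ+) (n : ℤ) :
    eisensteinTermExt τ s (m, n) = ((m : ℂ) * τ + n) ^ (-s) := by
  have h := linear_im_pos τ m n
  rw [eisensteinTermExt, Set.indicator_of_mem (by simp), ← lowerPow_eq_cpow]
  · simp
  · intro h0; simp [h0] at h
  · intro h0; rw [Complex.arg_eq_pi_iff] at h0; exact h.ne' h0.2

theorem eisensteinTermExt_neg_pnat (m : ℕ+) (n : ℤ) :
    eisensteinTermExt τ s (-m, -n) =
      Complex.exp (Real.pi * Complex.I * s) * eisensteinTermExt τ s (m, n) := by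
  rw [eisensteinTermExt, eisensteinTermExt, Set.indicator_of_mem (by simp),
    Set.indicator_of_mem (by simp)]
  have h := lowerPow_neg_of_im_pos (linear_im_pos τ m n) s
  rw [neg_add] at h
  simpa using h

theorem tsum_pnat_cpow_neg (hs : 1 < s.re) : ∑' n : ℕ+, (n : ℂ) ^ (-s) = riemannZeta s := by
  rw [tsum_pnat_eq_tsum_succ (f := fun n : ℕ => (n : ℂ) ^ (-s)),
    zeta_eq_tsum_one_div_nat_add_one_cpow hs]
  simp [Complex.cpow_neg]

theorem tsum_row_zero (hs : 2 < s.re) : ∑' n : ℤ, eisensteinTermExt τ s (0, n) =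
    (1 + Complex.exp (Real.pi * Complex.I * s)) * riemannZeta s := by
  rw [tsum_int_eq_zero_add_tsum_pnat ((summable_eisensteinTermExt τ hs).prod_factor 0)]
  simp only [eisensteinTermExt_zero_nat, eisensteinTermExt_zero_neg_nat]
  rw [tsum_mul_left, tsum_pnat_cpow_neg (by linarith), eisensteinTermExt,
    Set.indicator_of_notMem (by simp)]
  ring

theorem tsum_row_pnat (hs : 2 < s.re) (m : ℕ+) : ∑' n : ℤ, eisensteinTermExt τ s (m, n) =
    (2 * Real.pi : ℂ) ^ s * Complex.exp (-(Real.pi * Complex.I / 2 * s)) * (Complex.Gamma s)⁻¹ *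
      ∑' n : ℕ+, (n : ℂ) ^ (s - 1) * nome τ ^ (m * n : ℕ) := by
  simp only [eisensteinTermExt_pnat]
  rw [lipschitz_formula hs (by simpa using linear_im_pos τ m 0)]
  congr 1
  refine tsum_congr fun n => ?_
  rw [← exp_eq_nome_pow]
  congr 2
  push_cast
  ring

theorem tsum_row_neg_pnat (m : ℕ+) : ∑' n : ℤ, eisensteinTermExt τ s (-m, n) =
    Complex.exp (Real.pi * Complex.I * s) * ∑' n : ℤ, eisensteinTermExt τ s (m, n) := by
  rw [← (Equiv.neg ℤ).tsum_eq, ← tsum_mul_left]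
  exact tsum_congr fun n => eisensteinTermExt_neg_pnat τ m n

theorem tsum_eisensteinTermExt (hs : 2 < s.re) :
    ∑' p, eisensteinTermExt τ s p = eisensteinEntire τ s := by
  have hS := summable_eisensteinTermExt τ hs
  have ha : ∀ n : ℕ+, ‖(n : ℂ) ^ (s - 1)‖ ≤ (n : ℝ) ^ ⌈s.re⌉₊ := fun n =>
    norm_pnat_cpow_le (by simp; linarith [Nat.le_ceil s.re]) n
  have hs1 : s ≠ 1 := by
    rintro rfl
    norm_num at hs
  rw [hS.tsum_prod, tsum_int_eq_zero_add_tsum_pnat hS.prod]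
  simp only [tsum_row_zero τ hs, tsum_row_neg_pnat, tsum_row_pnat τ hs]
  rw [tsum_mul_left, tsum_mul_left, tsum_mul_left,
    tsum_tsum_eq_tsum_lambert ha (norm_nome_lt_one τ), eisensteinEntire, zetaPart,
    Function.update_of_ne hs1, lambertPower]
  ring

end Rows

theorem isEisensteinContinuation_eisensteinEntire (τ : UpperHalfPlane) :
    IsEisensteinContinuation τ (eisensteinEntire τ) := by
  refine ⟨differentiable_eisensteinEntire τ, fun s hs => ?_⟩
  have h := (summable_eisensteinTermExt τ hs).hasSum
  rw [tsum_eisensteinTermExt τ hs] at h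
  exact (hasSum_subtype_iff_indicator (s := {p : ℤ × ℤ | p ≠ (0, 0)})).mpr h

/-- `Classical.epsilon` has the defining property only once some continuation exists; the closed
form supplies one, and uniqueness identifies them. -/
theorem generalizedEisenstein_eq (τ : UpperHalfPlane) :
    (fun s => generalizedEisenstein s τ) = eisensteinEntire τ :=
  (Classical.epsilon_spec ⟨_, isEisensteinContinuation_eisensteinEntire τ⟩ :
    IsEisensteinContinuation τ _).unique (isEisensteinContinuation_eisensteinEntire τ)

/-! ### Derivatives at the negative even integers -/

theorem Complex.cos_natCast_mul_pi (n : ℕ) : Complex.cos (n * Real.pi) = (-1) ^ n := by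
  have := congrArg Complex.ofReal (Real.cos_nat_mul_pi n)
  push_cast at this
  exact this

/-- By the reflection formula, `1 / Γ(s) = Γ(1 - s) sin(π s) / π` near `-n`; the sine vanishes
there, so only its derivative contributes. -/
theorem hasDerivAt_Gamma_inv_neg_nat (n : ℕ) :
    HasDerivAt (fun s : ℂ => (Complex.Gamma s)⁻¹) ((-1) ^ n * (n.factorial : ℂ)) (-n) := by
  have hpi : (Real.pi : ℂ) ≠ 0 := by simp [Real.pi_ne_zero]
  have hΓ1 : Complex.Gamma (1 - -(n : ℂ)) = n.factorial := by
    rw [sub_neg_eq_add, add_comm, Complex.Gamma_nat_eq_factorial]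
  have hΓ : DifferentiableAt ℂ Complex.Gamma (1 - -(n : ℂ)) := by
    refine Complex.differentiableAt_Gamma _ fun m h => ?_
    have := congrArg Complex.re h
    simp at this
    have h1 : (0 : ℝ) ≤ n := by positivity
    have h2 : (0 : ℝ) ≤ m := by positivity
    linarith
  have hΓc : DifferentiableAt ℂ (fun s : ℂ => Complex.Gamma (1 - s)) (-(n : ℂ)) :=
    DifferentiableAt.comp (-(n : ℂ)) hΓ (by fun_prop)
  have hev : (fun s : ℂ => (Complex.Gamma s)⁻¹) =ᶠ[nhds (-(n : ℂ))]
      fun s => Complex.Gamma (1 - s) * (Complex.sin (Real.pi * s) / Real.pi) := by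
    have hne : Complex.Gamma (1 - -(n : ℂ)) ≠ 0 := by
      rw [hΓ1]
      exact_mod_cast n.factorial_ne_zero
    filter_upwards [hΓc.continuousAt.eventually_ne hne] with s hs
    rw [← inv_div, ← Complex.Gamma_mul_Gamma_one_sub, mul_inv, mul_comm, mul_assoc,
      inv_mul_cancel₀ hs, mul_one]
  have hsin : HasDerivAt (fun s : ℂ => Complex.sin (Real.pi * s) / Real.pi) ((-1) ^ n)
      (-(n : ℂ)) := by
    refine ((((hasDerivAt_id (-(n : ℂ))).const_mul (Real.pi : ℂ)).csin).div_const
      (Real.pi : ℂ)).congr_deriv ?_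
    have : Complex.cos (Real.pi * -(n : ℂ)) = (-1) ^ n := by
      rw [mul_neg, Complex.cos_neg, mul_comm, Complex.cos_natCast_mul_pi]
    simp only [id, this]
    field_simp
  refine ((hΓc.hasDerivAt.mul hsin).congr_of_eventuallyEq hev).congr_deriv ?_
  have h0 : Complex.sin (Real.pi * -(n : ℂ)) = 0 := by
    rw [mul_neg, Complex.sin_neg, mul_comm, Complex.sin_nat_mul_pi, neg_zero]
  rw [h0, hΓ1]
  ring

/-- Differentiate the functional equation for `ζ(1 - s)` at `s = 2k + 1`: the cosine factor
vanishes, so only its derivative contributes. -/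
theorem hasDerivAt_riemannZeta_neg_two_mul {k : ℕ} (hk : 1 ≤ k) :
    HasDerivAt riemannZeta ((-1) ^ k * ((2 * k).factorial : ℂ) / (2 * (2 * Real.pi : ℂ) ^ (2 * k)) *
      riemannZeta (2 * k + 1)) (-2 * k) := by
  have hpi : (Real.pi : ℂ) ≠ 0 := by simp [Real.pi_ne_zero]
  have h2pi : (2 * Real.pi : ℂ) ≠ 0 := by simp [Real.pi_ne_zero]
  set c : ℂ := 2 * k + 1 with hc
  have hcre : c.re = 2 * k + 1 := by simp [hc]
  have hk' : (1 : ℝ) ≤ k := by exact_mod_cast hk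
  have hcne : c ≠ 1 := fun h => by
    rw [h] at hcre
    simp at hcre
    linarith
  have hcn : ∀ n : ℕ, c ≠ -n := fun n h => by
    rw [h] at hcre
    simp at hcre
    have : (0 : ℝ) ≤ n := by positivity
    linarith
  have hneg : (-2 * k : ℂ) = 1 - c := by rw [hc]; ring
  have hζ : DifferentiableAt ℂ riemannZeta (-2 * k) := by
    refine differentiableAt_riemannZeta fun h => ?_
    have := congrArg Complex.re h
    simp at this
    linarith
  have hev : (fun s => riemannZeta (1 - s)) =ᶠ[nhds c] fun s =>
      (2 * (2 * Real.pi : ℂ) ^ (-s) * Complex.Gamma s * riemannZeta s) *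
        Complex.cos (Real.pi * s / 2) := by
    have hopen : IsOpen {s : ℂ | 1 < s.re} := isOpen_lt continuous_const Complex.continuous_re
    filter_upwards [hopen.mem_nhds (show 1 < c.re by rw [hcre]; linarith)] with s hs
    have hs : 1 < s.re := hs
    rw [riemannZeta_one_sub]
    · ring
    · rintro n rfl
      simp at hs
      have : (0 : ℝ) ≤ n := by positivity
      linarith
    · rintro rfl
      simp at hs
  have hcos0 : Complex.cos (Real.pi * c / 2) = 0 := by
    rw [Complex.cos_eq_zero_iff]
    exact ⟨k, by rw [hc]; push_cast; ring⟩
  have hsin : Complex.sin (Real.pi * c / 2) = (-1) ^ k := by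
    have : (Real.pi * c / 2 : ℂ) = k * Real.pi + Real.pi / 2 := by rw [hc]; ring
    rw [this, Complex.sin_add_pi_div_two, Complex.cos_natCast_mul_pi]
  have hcos : HasDerivAt (fun s : ℂ => Complex.cos (Real.pi * s / 2))
      (-(-1) ^ k * (Real.pi / 2)) c := by
    refine ((((hasDerivAt_id c).const_mul (Real.pi : ℂ)).div_const 2).ccos).congr_deriv ?_
    simp only [id, hsin]
    ring
  have hA : DifferentiableAt ℂ (fun s : ℂ =>
      2 * (2 * Real.pi : ℂ) ^ (-s) * Complex.Gamma s * riemannZeta s) c := by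
    refine DifferentiableAt.mul (DifferentiableAt.mul (DifferentiableAt.mul (by fun_prop) ?_)
      (Complex.differentiableAt_Gamma _ hcn)) (differentiableAt_riemannZeta hcne)
    exact differentiableAt_id.neg.const_cpow (Or.inl h2pi)
  have hD := (hA.hasDerivAt.mul hcos).congr_of_eventuallyEq hev
  have hL : HasDerivAt (fun s => riemannZeta (1 - s)) (-deriv riemannZeta (-2 * k)) c := by
    have h1 : HasDerivAt (fun s : ℂ => 1 - s) (-1) c := (hasDerivAt_id c).const_sub 1
    have h2 := hζ.hasDerivAt
    rw [hneg] at h2 ⊢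
    exact (h2.comp c h1).congr_deriv (by ring)
  have heq := hL.unique hD
  refine hζ.hasDerivAt.congr_deriv ?_
  have hΓ : Complex.Gamma c = (2 * k).factorial := by
    have : c = ((2 * k : ℕ) : ℂ) + 1 := by rw [hc]; push_cast; ring
    rw [this, Complex.Gamma_nat_eq_factorial]
  have hpow : (2 * Real.pi : ℂ) ^ (-c) = ((2 * Real.pi : ℂ) ^ (2 * k + 1))⁻¹ := by
    have : c = ((2 * k + 1 : ℕ) : ℂ) := by rw [hc]; push_cast; ring
    rw [Complex.cpow_neg, this, Complex.cpow_natCast]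
  rw [hcos0, mul_zero, zero_add, hΓ, hpow] at heq
  rw [← neg_neg (deriv riemannZeta (-2 * k)), heq, pow_succ]
  field_simp

theorem exp_pi_mul_I_mul_neg_two_mul (k : ℕ) :
    Complex.exp (Real.pi * Complex.I * (-2 * k)) = 1 := by
  rw [Complex.exp_eq_one_iff]
  exact ⟨-k, by push_cast; ring⟩

theorem exp_neg_pi_mul_I_div_two_mul_neg_two_mul (k : ℕ) :
    Complex.exp (-(Real.pi * Complex.I / 2 * (-2 * k))) = (-1) ^ k := by
  rw [← Complex.exp_pi_mul_I, ← Complex.exp_nat_mul]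
  congr 1
  ring

theorem hasDerivAt_zetaPart_neg_two_mul {k : ℕ} (hk : 1 ≤ k) :
    HasDerivAt zetaPart ((-1) ^ k * ((2 * k).factorial : ℂ) / (2 * Real.pi : ℂ) ^ (2 * k) *
      riemannZeta (2 * k + 1)) (-2 * k) := by
  have hne : (-2 * k : ℂ) ≠ 1 := fun h => by
    have := congrArg Complex.re h
    simp at this
    have hk' : (1 : ℝ) ≤ k := by exact_mod_cast hk
    linarith
  have hev : zetaPart =ᶠ[nhds (-2 * k : ℂ)]
      fun s => (1 + Complex.exp (Real.pi * Complex.I * s)) * riemannZeta s := by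
    filter_upwards [isOpen_ne.mem_nhds hne] with s hs
    exact Function.update_of_ne hs _ _
  have h0 : riemannZeta (-2 * k) = 0 := by
    obtain ⟨j, rfl⟩ := Nat.exists_eq_add_of_le' hk
    simpa using riemannZeta_neg_two_mul_nat_add_one j
  have hE : DifferentiableAt ℂ (fun s => 1 + Complex.exp (Real.pi * Complex.I * s))
      (-2 * k : ℂ) := by fun_prop
  refine ((hE.hasDerivAt.mul (hasDerivAt_riemannZeta_neg_two_mul hk)).congr_of_eventuallyEq
    hev).congr_deriv ?_
  rw [h0, exp_pi_mul_I_mul_neg_two_mul]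
  have hpi : (Real.pi : ℂ) ≠ 0 := by simp [Real.pi_ne_zero]
  field_simp
  ring

theorem deriv_eisensteinEntire {k : ℕ} (hk : 1 ≤ k) (τ : UpperHalfPlane) :
    deriv (eisensteinEntire τ) (-2 * k) =
      (-1) ^ k * ((2 * k).factorial : ℂ) / (2 * Real.pi : ℂ) ^ (2 * k) *
        (riemannZeta (2 * k + 1) + 2 * lambertPower (nome τ) (-2 * k)) := by
  have h2 : (2 * Real.pi : ℂ) ≠ 0 := by simp [Real.pi_ne_zero]
  have hB : DifferentiableAt ℂ (fun s => (1 + Complex.exp (Real.pi * Complex.I * s)) *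
      ((2 * Real.pi : ℂ) ^ s * Complex.exp (-(Real.pi * Complex.I / 2 * s)) *
        lambertPower (nome τ) s)) (-2 * k : ℂ) := by
    refine DifferentiableAt.mul (by fun_prop) (DifferentiableAt.mul (DifferentiableAt.mul ?_
      (by fun_prop)) (differentiable_lambertPower (norm_nome_lt_one τ) _))
    exact differentiableAt_id.const_cpow (Or.inl h2)
  have hΓ := hasDerivAt_Gamma_inv_neg_nat (2 * k)
  have hc : (-((2 * k : ℕ) : ℂ)) = -2 * k := by push_cast; ring
  rw [hc] at hΓ
  have hΓ0 : (Complex.Gamma (-2 * k))⁻¹ = 0 := by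
    rw [← hc, Complex.Gamma_neg_nat_eq_zero, inv_zero]
  -- With `1 / Γ` isolated as the last factor, its zero kills the product-rule term containing the
  -- derivative of `lambertPower`.
  have hfun : eisensteinEntire τ = fun s => zetaPart s +
      ((1 + Complex.exp (Real.pi * Complex.I * s)) *
      ((2 * Real.pi : ℂ) ^ s * Complex.exp (-(Real.pi * Complex.I / 2 * s)) *
        lambertPower (nome τ) s)) * (Complex.Gamma s)⁻¹ := by
    funext s
    rw [eisensteinEntire]
    ring
  have hD := (hasDerivAt_zetaPart_neg_two_mul hk).add (hB.hasDerivAt.mul hΓ)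
  rw [hfun]
  refine hD.deriv.trans ?_
  have hpow : (2 * Real.pi : ℂ) ^ (-2 * k : ℂ) = ((2 * Real.pi : ℂ) ^ (2 * k))⁻¹ := by
    rw [← hc, Complex.cpow_neg, Complex.cpow_natCast]
  rw [hΓ0, mul_zero, zero_add, exp_pi_mul_I_mul_neg_two_mul,
    exp_neg_pi_mul_I_div_two_mul_neg_two_mul, hpow, pow_mul (-1) 2 k, neg_one_sq,
    one_pow]
  field_simp
  ring

/-! ### Behaviour at `i∞` -/

/-- For `s.re ≤ 1` the coefficients have norm at most `1`; the sum starts at `n = 1`, hence the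
factor `‖q‖` that forces decay at `i∞`. -/
theorem norm_lambertPower_le {q s : ℂ} (hs : s.re ≤ 1) (hq : ‖q‖ < 1) :
    ‖lambertPower q s‖ ≤ ‖q‖ * (1 - ‖q‖)⁻¹ * (1 - ‖q‖)⁻¹ := by
  have h1 : HasSum (fun n : ℕ+ => ‖q‖ ^ (n : ℕ)) (‖q‖ * (1 - ‖q‖)⁻¹) := by
    rw [hasSum_pnat_iff_hasSum_succ (f := fun n : ℕ => ‖q‖ ^ n)]
    simpa [pow_succ'] using (hasSum_geometric_of_lt_one (norm_nonneg q) hq).mul_left ‖q‖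
  refine tsum_of_norm_bounded (h1.mul_right _) fun n => ?_
  have h := norm_lambert_term_le (b := 1) (c := (n : ℂ) ^ (s - 1))
    (by simpa using norm_pnat_cpow_le (K := 0) (by simpa using hs) n) hq n
  rwa [one_mul] at h

theorem tendsto_norm_nome : Filter.Tendsto (fun τ : UpperHalfPlane => ‖nome τ‖)
    UpperHalfPlane.atImInfty (nhds 0) := by
  have h : (fun τ : UpperHalfPlane => ‖nome τ‖) =
      fun τ => Real.exp (-(2 * Real.pi * τ.im)) := by
    funext τ
    rw [nome, Complex.norm_exp]
    congr 1
    simp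
  rw [h]
  refine Real.tendsto_exp_neg_atTop_nhds_zero.comp ?_
  exact Filter.Tendsto.const_mul_atTop (by positivity) Filter.tendsto_comap

theorem tendsto_lambertPower_nome {s : ℂ} (hs : s.re ≤ 1) :
    Filter.Tendsto (fun τ : UpperHalfPlane => lambertPower (nome τ) s)
      UpperHalfPlane.atImInfty (nhds 0) := by
  refine squeeze_zero_norm (fun τ => norm_lambertPower_le hs (norm_nome_lt_one τ)) ?_
  have h1 : Filter.Tendsto (fun τ : UpperHalfPlane => (1 - ‖nome τ‖)⁻¹)
      UpperHalfPlane.atImInfty (nhds 1) := by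
    simpa using (tendsto_norm_nome.const_sub 1).inv₀ (by norm_num)
  simpa using (tendsto_norm_nome.mul h1).mul h1

/-! ### The expansions -/

theorem cpow_neg_two_mul_sub_one (k n : ℕ) :
    (n : ℂ) ^ ((-2 * k : ℂ) - 1) = (n : ℂ) ^ (-2 * (k : ℤ) - 1) := by
  rw [← Complex.cpow_intCast]
  congr 1
  push_cast
  ring

theorem hasSum_divisorPowSum (k : ℕ) (τ : UpperHalfPlane) :
    HasSum (fun n : ℕ+ => divisorPowSum (-2 * (k : ℤ) - 1) n *
      Complex.exp (2 * Real.pi * Complex.I * n * (τ : ℂ))) (lambertPower (nome τ) (-2 * k)) := by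
  have h := hasSum_divisors_lambert (f := fun n => (n : ℂ) ^ ((-2 * k : ℂ) - 1)) (K := 0)
    (fun n => norm_pnat_cpow_le (by simp; linarith [(Nat.cast_nonneg k : (0 : ℝ) ≤ k)]) n)
    (norm_nome_lt_one τ)
  convert! h using 2 with n
  rw [exp_eq_nome_pow, divisorPowSum]
  simp only [cpow_neg_two_mul_sub_one]

/-- Splitting `1 / (1 - x) = 1 + x / (1 - x)` separates `ζ(2k + 1)`; doubling counts it twice, which
explains the subtracted zeta value in the first expansion. -/
theorem hasSum_lambert_two {k : ℕ} (hk : 1 ≤ k) (τ : UpperHalfPlane) :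
    HasSum (fun n : ℕ+ => (n : ℂ) ^ (-2 * (k : ℤ) - 1) /
      (1 - Complex.exp (2 * Real.pi * Complex.I * n * (τ : ℂ))))
      (riemannZeta (2 * k + 1) + lambertPower (nome τ) (-2 * k)) := by
  have hk' : (1 : ℝ) ≤ k := by exact_mod_cast hk
  have hre : 1 < (2 * k + 1 : ℂ).re := by
    simp
    linarith
  have h1 : HasSum (fun n : ℕ+ => (n : ℂ) ^ ((-2 * k : ℂ) - 1)) (riemannZeta (2 * k + 1)) := by
    have hs : Summable fun n : ℕ+ => (n : ℂ) ^ (-(2 * k + 1 : ℂ)) := by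
      refine (((Complex.summable_one_div_nat_cpow (p := 2 * k + 1)).mpr hre).comp_injective
        PNat.coe_injective).congr fun n => ?_
      rw [Function.comp_apply, Complex.cpow_neg, one_div]
    have := hs.hasSum
    rw [tsum_pnat_cpow_neg hre] at this
    have he : (-2 * k : ℂ) - 1 = -(2 * k + 1) := by ring
    rwa [he]
  have h2 := (summable_lambert (a := fun n : ℕ+ => (n : ℂ) ^ ((-2 * k : ℂ) - 1)) (K := 0)
    (fun n => norm_pnat_cpow_le (by simp; linarith) n) (norm_nome_lt_one τ)).hasSum
  convert! h1.add h2 using 2 with n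
  have hne : 1 - nome τ ^ (n : ℕ) ≠ 0 := by
    rw [← norm_pos_iff]
    exact lt_of_lt_of_le (by linarith [norm_nome_lt_one τ])
      (norm_one_sub_pow_ge (norm_nome_lt_one τ) n)
  rw [exp_eq_nome_pow, cpow_neg_two_mul_sub_one]
  field_simp
  ring

theorem diffEisenstein_neg_two_mul {k : ℕ} (hk : 1 ≤ k) (τ : UpperHalfPlane) :
    diffEisenstein (-2 * (k : ℤ)) τ =
      (-1) ^ k * ((2 * k).factorial : ℂ) / (2 * Real.pi : ℂ) ^ (2 * k) *
        (riemannZeta (2 * k + 1) + 2 * lambertPower (nome τ) (-2 * k)) := by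
  rw [diffEisenstein, generalizedEisenstein_eq, ← deriv_eisensteinEntire hk τ]
  congr 1
  push_cast
  ring

theorem theorem5p9 (k : ℕ) (hk : 1 ≤ k) :
    (∀ τ : UpperHalfPlane,
      -- `G(s, τ)` really is the analytic continuation of the generalized Eisenstein series
      IsEisensteinContinuation τ (fun s => generalizedEisenstein s τ) ∧
      -- the Lambert series and its value
      Summable (fun n : ℕ+ => (n : ℂ) ^ (-2 * (k : ℤ) - 1) /
          (1 - Complex.exp (2 * Real.pi * Complex.I * n * (τ : ℂ)))) ∧
      diffEisenstein (-2 * (k : ℤ)) τ =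
        (-1) ^ k * ((2 * k).factorial : ℂ) / (2 * Real.pi : ℂ) ^ (2 * k) *
          (2 * (∑' n : ℕ+, (n : ℂ) ^ (-2 * (k : ℤ) - 1) /
              (1 - Complex.exp (2 * Real.pi * Complex.I * n * (τ : ℂ)))) -
            riemannZeta (2 * k + 1)) ∧
      -- the Fourier expansion
      Summable (fun n : ℕ+ => divisorPowSum (-2 * (k : ℤ) - 1) n *
          Complex.exp (2 * Real.pi * Complex.I * n * (τ : ℂ))) ∧
      diffEisenstein (-2 * (k : ℤ)) τ =
        (-1) ^ k * ((2 * k).factorial : ℂ) / (2 * Real.pi : ℂ) ^ (2 * k) *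
          (riemannZeta (2 * k + 1) +
            2 * ∑' n : ℕ+, divisorPowSum (-2 * (k : ℤ) - 1) n *
              Complex.exp (2 * Real.pi * Complex.I * n * (τ : ℂ)))) ∧
    -- the constant term, that is, the value at `i∞`
    Filter.Tendsto (diffEisenstein (-2 * (k : ℤ))) UpperHalfPlane.atImInfty
      (nhds ((-1) ^ k * ((2 * k).factorial : ℂ) / (2 * Real.pi : ℂ) ^ (2 * k) *
        riemannZeta (2 * k + 1))) ∧
    (-1) ^ k * ((2 * k).factorial : ℂ) / (2 * Real.pi : ℂ) ^ (2 * k) *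
        riemannZeta (2 * k + 1) ≠ 0 := by
  refine ⟨fun τ => ⟨?_, (hasSum_lambert_two hk τ).summable, ?_, (hasSum_divisorPowSum k τ).summable,
    ?_⟩, ?_, ?_⟩
  · rw [generalizedEisenstein_eq]
    exact isEisensteinContinuation_eisensteinEntire τ
  · rw [(hasSum_lambert_two hk τ).tsum_eq, diffEisenstein_neg_two_mul hk]
    ring
  · rw [(hasSum_divisorPowSum k τ).tsum_eq, diffEisenstein_neg_two_mul hk]
  · rw [funext (diffEisenstein_neg_two_mul hk)]
    have hre : (-2 * k : ℂ).re ≤ 1 := by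
      simp
      linarith [(Nat.cast_nonneg k : (0 : ℝ) ≤ k)]
    simpa using (((tendsto_lambertPower_nome hre).const_mul 2).const_add
      (riemannZeta (2 * k + 1))).const_mul
      ((-1) ^ k * ((2 * k).factorial : ℂ) / (2 * Real.pi : ℂ) ^ (2 * k))
  · have h1 : riemannZeta (2 * k + 1) ≠ 0 := riemannZeta_ne_zero_of_one_le_re (by simp)
    have h2 : ((2 * k).factorial : ℂ) ≠ 0 := by exact_mod_cast (2 * k).factorial_ne_zero
    have h3 : (2 * Real.pi : ℂ) ≠ 0 := by simp [Real.pi_ne_zero]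
    exact mul_ne_zero (div_ne_zero (mul_ne_zero (by simp) h2) (pow_ne_zero _ h3)) h1
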